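/- Let $N>1$ be an integer, let $p\ge N$ be real, and let $f\colon\mathbb R\to[0,+\infty)$ be a continuous function such that $f(t)>0$ for every $t<0$, $f$ is non-increasing on $(-\infty,0)$, and $$\int_{-\infty}^{-1}\left(\int_t^{-1}f(s)\,ds\right)^{-1/p}dt<+\infty .$$ A solution of $$-\operatorname{div}\left(|\nabla u|^{p-2}\nabla u\right)\ge f(u)\quad\text{on }\mathbb R^N \qquad (*)$$ means a function $u\in C^1(\mathbb R^N)$ such that $$\int_{\mathbb R^N}|\nabla u|^{p-2}\,\nabla u\cdot\nabla\varphi\,dx\ \ge\ \int_{\mathbb R^N}f(u)\,\varphi\,dx$$ for every nonnegative $\varphi\in C^1(\mathbb R^N)$ with compact support. If $u$ is a solution of $(*)$, then $u$ is constant on $\mathbb R^N$; more precisely, $u\equiv\alpha$ for some $\alpha\ge 0$ with $f(\alpha)=0$. Moreover, if $f(t)>0$ for every $t\ge 0$, then $(*)$ has no solutions. -/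

import Mathlib

open MeasureTheory Set

noncomputable section

namespace PLaplace

/-- Sign and monotonicity condition on the nonlinearity: `f > 0` on the negative half line and
`f` is non-increasing there. -/
def PosAntitoneOnNeg (f : ℝ → ℝ) : Prop :=
  (∀ t : ℝ, t < 0 → 0 < f t) ∧ AntitoneOn f (Iio 0)

/-- The Keller–Osserman condition at `-∞` with exponent `p`:
`∫_{-∞}^{-1} (∫_t^{-1} f(s) ds)^{-1/p} dt < +∞`. -/
def KellerOsserman (p : ℝ) (f : ℝ → ℝ) : Prop :=
  IntegrableOn (fun t : ℝ => (∫ s in t..(-1), f s) ^ (-(1 / p))) (Iio (-1)) volume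

/-- `u` is a (weak, `C¹`) solution of `-div(|∇u|^{p-2} ∇u) ≥ f(u)` on `ℝ^N`: `u` is `C¹` and
`∫ |∇u|^{p-2} ∇u · ∇φ ≥ ∫ f(u) φ` for every nonnegative compactly supported `C¹` function `φ`. -/
def IsSolution {N : ℕ} (p : ℝ) (f : ℝ → ℝ) (u : EuclideanSpace ℝ (Fin N) → ℝ) : Prop :=
  ContDiff ℝ 1 u ∧
    ∀ φ : EuclideanSpace ℝ (Fin N) → ℝ, ContDiff ℝ 1 φ → HasCompactSupport φ →
      (∀ x, 0 ≤ φ x) →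
        ∫ x, f (u x) * φ x ≤
          ∫ x, inner ℝ (‖gradient u x‖ ^ (p - 2) • gradient u x) (gradient φ x)

end PLaplace

end

/-! Two independent facts are combined.

Nonnegativity. With `w = -u` and `g s = f (-s)`, `w` satisfies `Δ_p w ≥ g(w)` weakly. The
Keller–Osserman integral bounds the time that the 1D problem `(v'^(p-1))' = c g(v)`, `v(0) = a > 0`,
`v'(0) = 0`, takes to climb to any level `M`, uniformly in `M` (`exists_radial_profile`). Since `c
g(v)` is nondecreasing, the radial field with flux `V = v'^(p-1)` has divergence `V' + (N-1) V / r ≤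
N c g(v)`, so `N c ≤ 1/2` makes `v(|x|)` a supersolution with room to spare. Taking `M` above the
maximum of `w` on a fixed ball, comparison (`subsolution_apply_zero_le`) yields `w 0 ≤ a`. As `a`
can be taken below any positive value of `w 0`, and the problem is translation invariant, `u ≥ 0`.

Rigidity. Now `u ≥ 0` is `p`-superharmonic because `f ≥ 0`. A logarithmic Caccioppoli estimate
(`integral_log_gradient_le`) bounds the local energy of `log (u + 1)` by the energy of a cutoff, and
for `p ≥ N` that energy can be made arbitrarily small (`exists_cutoff_small_energy`). Hence `∇u =
0`, and testing the inequality for a constant gives `f(α) ≤ 0`. -/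

noncomputable section

namespace PLaplace

/-! ### Radial profiles from the Keller–Osserman condition -/

/-- The autonomous equation `v' = H(v)` on the line: if `1 / H` is integrable on `(a, ∞)`, the
solution leaving `a` reaches every level `M` before the time `∫ 1 / H`. -/
theorem exists_increasing_solution {H : ℝ → ℝ} {a M : ℝ} (haM : a < M) (hc : Continuous H)
    (hpos : ∀ s, a < s → 0 < H s) (hint : IntegrableOn (fun s => (H s)⁻¹) (Ioi a)) :
    ∃ R₁, 0 < R₁ ∧ R₁ ≤ ∫ s in Ioi a, (H s)⁻¹ ∧ ∃ v : ℝ → ℝ, Continuous v ∧ StrictMono v ∧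
      v 0 = a ∧ v R₁ = M ∧ ∀ r ∈ Ioo 0 R₁, HasDerivAt v (H (v r)) r := by
  classical
  -- Only the values on `(a, M]` matter; the value 1 elsewhere makes the primitive an increasing
  -- bijection of `ℝ`, so that its inverse is a globally defined `v`. `H` may vanish at `a`.
  set θ : ℝ → ℝ := (Ioc a M).piecewise (fun s => (H s)⁻¹) (fun _ => 1) with hθ
  have hθpos : ∀ s, 0 < θ s := by
    intro s
    by_cases hs : s ∈ Ioc a M
    · simp only [hθ, piecewise_eq_of_mem _ _ _ hs]
      exact inv_pos.2 (hpos s hs.1)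
    · simp [hθ, piecewise_eq_of_notMem _ _ _ hs]
  have hθint : ∀ x y, IntervalIntegrable θ volume x y := by
    intro x y
    rw [intervalIntegrable_iff, hθ]
    have h1 : IntegrableOn (fun s => (H s)⁻¹) (Ioc a M) := hint.mono_set Ioc_subset_Ioi_self
    have h2 : IntegrableOn (fun _ : ℝ => (1 : ℝ)) (uIoc x y) :=
      integrableOn_const (by simp [uIoc])
    have e : (Ioc a M).piecewise (fun s => (H s)⁻¹) (fun _ => (1 : ℝ))
        = fun s => (Ioc a M).indicator (fun s => (H s)⁻¹) s +
          (Ioc a M)ᶜ.indicator (fun _ => (1 : ℝ)) s := by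
      ext s
      by_cases hs : s ∈ Ioc a M
      · simp [hs, -mem_Ioc]
      · simp [hs, -mem_Ioc]
    rw [e]
    exact ((integrable_indicator_iff measurableSet_Ioc).2 h1).integrableOn.add
      (h2.indicator measurableSet_Ioc.compl)
  set Ψ : ℝ → ℝ := fun s => ∫ t in a..s, θ t with hΨ
  have hΨc : Continuous Ψ := intervalIntegral.continuous_primitive hθint a
  have hsub : ∀ x y, Ψ y - Ψ x = ∫ t in x..y, θ t := fun x y =>
    intervalIntegral.integral_interval_sub_left (hθint _ _) (hθint _ _)
  have hmono : StrictMono Ψ := by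
    intro x y hxy
    rw [← sub_pos, hsub]
    exact intervalIntegral.intervalIntegral_pos_of_pos (hθint _ _) hθpos hxy
  have hright : ∀ s, M ≤ s → Ψ s = Ψ M + (s - M) := by
    intro s hs
    have : ∫ t in M..s, θ t = ∫ t in M..s, (1 : ℝ) := by
      apply intervalIntegral.integral_congr_ae
      refine Filter.Eventually.of_forall fun t ht => ?_
      rw [uIoc_of_le hs] at ht
      simp [hθ, ht.1.not_ge]
    have h := hsub M s
    rw [this] at h
    simp at h
    linarith
  have hleft : ∀ s, s ≤ a → Ψ s = s - a := by
    intro s hs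
    have : ∫ t in s..a, θ t = ∫ t in s..a, (1 : ℝ) := by
      apply intervalIntegral.integral_congr_ae
      refine Filter.Eventually.of_forall fun t ht => ?_
      rw [uIoc_of_le hs] at ht
      simp [hθ, ht.2.not_gt]
    have h := hsub s a
    rw [this] at h
    simp [hΨ] at h
    simp only [hΨ]
    linarith
  have hsurj : Function.Surjective Ψ := by
    apply hΨc.surjective
    · refine Filter.tendsto_atTop_mono' _ ?_
        (Filter.tendsto_atTop_add_const_left Filter.atTop (Ψ M - M) Filter.tendsto_id)
      filter_upwards [Filter.eventually_ge_atTop M] with s hs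
      rw [hright s hs]; simp; linarith
    · refine Filter.tendsto_atBot_mono' _ ?_
        (Filter.tendsto_atBot_add_const_left Filter.atBot (-a) Filter.tendsto_id)
      filter_upwards [Filter.eventually_le_atBot a] with s hs
      rw [hleft s hs]; simp
  set e := hmono.orderIsoOfSurjective Ψ hsurj with he
  have heΨ : ∀ s, e s = Ψ s := fun s => rfl
  have hΨa : Ψ a = 0 := by simp [hΨ]
  have hv : ∀ s, e.symm (Ψ s) = s := fun s => by rw [← heΨ]; simp
  refine ⟨Ψ M, ?_, ?_, e.symm, e.symm.continuous, e.symm.strictMono, ?_, hv M, ?_⟩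
  · rw [← hΨa]; exact hmono haM
  · simp only [hΨ]
    rw [intervalIntegral.integral_of_le haM.le,
      setIntegral_congr_fun (g := fun s => (H s)⁻¹) measurableSet_Ioc
        (fun t ht => by simp only [hθ, piecewise_eq_of_mem _ _ _ ht])]
    refine setIntegral_mono_set hint ?_ (Filter.Eventually.of_forall Ioc_subset_Ioi_self)
    exact (ae_restrict_iff' measurableSet_Ioi).2
      (Filter.Eventually.of_forall fun s hs => (inv_pos.2 (hpos s hs)).le)
  · have := hv a; rwa [hΨa] at this
  · intro r hr
    have hs1 : a < e.symm r := by
      rw [← hv a, hΨa]; exact e.symm.strictMono hr.1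
    have hs2 : e.symm r < M := by
      rw [← hv M]; exact e.symm.strictMono hr.2
    have hloc : θ =ᶠ[nhds (e.symm r)] fun s => (H s)⁻¹ := by
      filter_upwards [Ioo_mem_nhds hs1 hs2] with s hs
      simp only [hθ, piecewise_eq_of_mem _ _ _ (Ioo_subset_Ioc_self hs)]
    have hcont : ContinuousAt θ (e.symm r) :=
      ((hc.continuousAt.inv₀ (hpos _ hs1).ne').congr hloc.symm)
    have hmeas : StronglyMeasurableAtFilter θ (nhds (e.symm r)) volume :=
      ⟨univ, Filter.univ_mem, by
        have : Measurable θ := (hc.measurable.inv).piecewise measurableSet_Ioc measurable_const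
        exact this.aestronglyMeasurable⟩
    have hd : HasDerivAt Ψ (θ (e.symm r)) (e.symm r) :=
      intervalIntegral.integral_hasDerivAt_right (hθint _ _) hmeas hcont
    have := HasDerivAt.of_local_left_inverse (g := e.symm) e.symm.continuous.continuousAt hd
      (hθpos _).ne' (Filter.Eventually.of_forall fun y => by rw [← heΨ]; simp)
    rwa [hloc.eq_of_nhds, inv_inv] at this

/-- Radial profile of a large solution: `v` solves `(v'^{p-1})' = c g(v)` starting from `v(0) = a`
with zero slope, and attains any level `M` within a radius independent of `M`. -/
theorem exists_radial_profile {g : ℝ → ℝ} {p a c : ℝ} (hp : 1 < p) (ha : 0 < a) (ha1 : a < 1)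
    (hc : 0 < c) (hgc : Continuous g) (hg : ∀ s, 0 < s → 0 < g s) (hgm : MonotoneOn g (Ioi 0))
    (hKO : IntegrableOn (fun s => (∫ τ in (1 : ℝ)..s, g τ) ^ (-(1 / p))) (Ioi 1)) :
    ∃ R : ℝ, ∀ M, a < M → ∃ R₁, 0 < R₁ ∧ R₁ ≤ R ∧ ∃ v d : ℝ → ℝ, Continuous v ∧ StrictMono v ∧
      v 0 = a ∧ v R₁ = M ∧ Continuous d ∧ d 0 = 0 ∧ ∀ r ∈ Ioo 0 R₁, 0 < d r ∧
        HasDerivAt v (d r) r ∧ HasDerivAt (fun r => d r ^ (p - 1)) (c * g (v r)) r := by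
  have hp0 : 0 < p := by linarith
  have hgi : ∀ x y, IntervalIntegrable g volume x y := fun x y => hgc.intervalIntegrable x y
  set G : ℝ → ℝ := fun s => ∫ τ in a..s, g τ with hG
  have hGd : ∀ s, HasDerivAt G (g s) s := fun s => hgc.integral_hasStrictDerivAt a s |>.hasDerivAt
  have hGc : Continuous G := continuous_iff_continuousAt.2 fun s => (hGd s).continuousAt
  have hGlow : ∀ s, a ≤ s → g a * (s - a) ≤ G s := by
    intro s hs
    have : ∫ τ in a..s, g a ≤ G s :=
      intervalIntegral.integral_mono_on hs (by simp) (hgi _ _)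
        fun x hx => hgm ha (ha.trans_le hx.1) hx.1
    simpa [mul_comm] using this
  have hGpos : ∀ s, a < s → 0 < G s := fun s hs =>
    lt_of_lt_of_le (mul_pos (hg a ha) (sub_pos.2 hs)) (hGlow s hs.le)
  -- Normalization turning the first integral `(p-1)/p * v'^p = c G(v)` into `v' = H(v)`.
  set b : ℝ := (c * p / (p - 1)) ^ (1 / p) with hb
  have hb0 : 0 < b := Real.rpow_pos_of_pos (div_pos (mul_pos hc hp0) (by linarith)) _
  have hbp : b ^ p = c * p / (p - 1) := by
    rw [hb, ← Real.rpow_mul (div_pos (mul_pos hc hp0) (by linarith)).le]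
    simp [hp0.ne']
  set H : ℝ → ℝ := fun s => b * G s ^ (1 / p) with hH
  have hHc : Continuous H := continuous_const.mul
    (hGc.rpow_const fun _ => Or.inr (by positivity))
  have hHpos : ∀ s, a < s → 0 < H s := fun s hs =>
    mul_pos hb0 (Real.rpow_pos_of_pos (hGpos s hs) _)
  have hHinv : ∀ s, a < s → (H s)⁻¹ = b⁻¹ * G s ^ (-(1 / p)) := fun s hs => by
    simp only [hH]
    rw [mul_inv, Real.rpow_neg (hGpos s hs).le]
  have hmeas : Measurable fun s => (H s)⁻¹ := hHc.measurable.inv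
  have hint : IntegrableOn (fun s => (H s)⁻¹) (Ioi a) := by
    rw [← Ioc_union_Ioi_eq_Ioi ha1.le]
    refine IntegrableOn.union ?_ ?_
    -- Near `a`, `G` grows at least linearly, so `1 / H` is at most a multiple of `(s - a)^(-1/p)`,
    -- integrable since `p > 1`. Beyond 1 the Keller–Osserman hypothesis takes over.
    · have h1 : IntegrableOn (fun s : ℝ => b⁻¹ * (g a ^ (-(1 / p)) * (s - a) ^ (-(1 / p))))
          (Ioc a 1) := by
        have h2 : IntervalIntegrable (fun s : ℝ => s ^ (-(1 / p))) volume (a - a) (1 - a) :=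
          intervalIntegral.intervalIntegrable_rpow' (by
            have : 1 / p < 1 := by rw [div_lt_one hp0]; exact hp
            linarith)
        have h3 := (h2.comp_sub_right a).1
        simp only [sub_add_cancel] at h3
        exact (h3.const_mul _).const_mul _
      refine Integrable.mono' h1 hmeas.aestronglyMeasurable ?_
      refine (ae_restrict_iff' measurableSet_Ioc).2 (Filter.Eventually.of_forall fun s hs => ?_)
      rw [Real.norm_of_nonneg (inv_pos.2 (hHpos s hs.1)).le, hHinv s hs.1,
        ← Real.mul_rpow (hg a ha).le (sub_pos.2 hs.1).le]
      refine mul_le_mul_of_nonneg_left ?_ (inv_pos.2 hb0).le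
      exact Real.rpow_le_rpow_of_nonpos (mul_pos (hg a ha) (sub_pos.2 hs.1)) (hGlow s hs.1.le)
        (by simp [hp0.le])
    · refine Integrable.mono' (hKO.const_mul b⁻¹) hmeas.aestronglyMeasurable ?_
      refine (ae_restrict_iff' measurableSet_Ioi).2 (Filter.Eventually.of_forall fun s hs => ?_)
      have hs' : a < s := ha1.trans hs
      rw [Real.norm_of_nonneg (inv_pos.2 (hHpos s hs')).le, hHinv s hs']
      refine mul_le_mul_of_nonneg_left ?_ (inv_pos.2 hb0).le
      have h1 : 0 < ∫ τ in (1 : ℝ)..s, g τ := by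
        refine intervalIntegral.intervalIntegral_pos_of_pos_on (hgi _ _) (fun x hx => ?_) hs
        exact hg x (zero_lt_one.trans hx.1)
      refine Real.rpow_le_rpow_of_nonpos h1 ?_ (by simp [hp0.le])
      have h2 : G 1 + ∫ τ in (1 : ℝ)..s, g τ = G s :=
        intervalIntegral.integral_add_adjacent_intervals (hgi _ _) (hgi _ _)
      linarith [hGpos 1 ha1]
  refine ⟨∫ s in Ioi a, (H s)⁻¹, fun M hM => ?_⟩
  obtain ⟨R₁, hR, hRR, v, hvc, hvm, hv0, hvM, hvd⟩ :=
    exists_increasing_solution hM hHc hHpos hint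
  refine ⟨R₁, hR, hRR, v, fun r => H (v r), hvc, hvm, hv0, hvM, hHc.comp hvc, ?_, ?_⟩
  · simp [hv0, hH, hG, hp0.ne']
  · intro r hr
    have hvr : a < v r := by rw [← hv0]; exact hvm hr.1
    refine ⟨hHpos _ hvr, hvd r hr, ?_⟩
    have hGr := hGpos _ hvr
    have h1 : HasDerivAt (fun r => G (v r)) (g (v r) * H (v r)) r :=
      (hGd (v r)).comp r (hvd r hr)
    have h2 := (h1.rpow_const (p := (p - 1) / p) (Or.inl hGr.ne')).const_mul (b ^ (p - 1))
    have h3 : (fun r => H (v r) ^ (p - 1)) =ᶠ[nhds r]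
        fun r => b ^ (p - 1) * G (v r) ^ ((p - 1) / p) := by
      filter_upwards [Ioi_mem_nhds hr.1] with t ht
      have hvt : a < v t := by rw [← hv0]; exact hvm ht
      simp only [hH]
      rw [Real.mul_rpow hb0.le (Real.rpow_nonneg (hGpos _ hvt).le _),
        ← Real.rpow_mul (hGpos _ hvt).le]
      congr 2
      field_simp
    refine (h2.congr_of_eventuallyEq h3).congr_deriv ?_
    simp only [hH]
    have h4 : G (v r) ^ ((p - 1) / p - 1) = (G (v r) ^ (1 / p))⁻¹ := by
      rw [← Real.rpow_neg hGr.le]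
      congr 1
      field_simp
      ring
    have h5 : b ^ (p - 1) * b = c * p / (p - 1) := by
      rw [← hbp]
      nth_rewrite 2 [← Real.rpow_one b]
      rw [← Real.rpow_add hb0]
      congr 1; ring
    have h6 : G (v r) ^ (1 / p) ≠ 0 := (Real.rpow_pos_of_pos hGr _).ne'
    rw [h4]
    have h7 : p - 1 ≠ 0 := by linarith
    calc b ^ (p - 1) * (g (v r) * (b * G (v r) ^ (1 / p)) * ((p - 1) / p) * (G (v r) ^ (1 / p))⁻¹)
        = (b ^ (p - 1) * b) * g (v r) * ((p - 1) / p) *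
          (G (v r) ^ (1 / p) * (G (v r) ^ (1 / p))⁻¹) := by ring
      _ = c * g (v r) := by
        rw [h5, mul_inv_cancel₀ h6]
        field_simp

/-! ### Calculus of radial functions -/

open Filter Topology

section Radial

variable {F : Type*} [NormedAddCommGroup F] [InnerProductSpace ℝ F]

theorem hasFDerivAt_norm {x : F} (hx : x ≠ 0) :
    HasFDerivAt (fun y : F => ‖y‖) (‖x‖⁻¹ • innerSL ℝ x) x := by
  have h := (hasStrictFDerivAt_norm_sq x).hasFDerivAt.sqrt (by simpa using hx)
  refine (h.congr_of_eventuallyEq (Eventually.of_forall fun y => ?_)).congr_fderiv ?_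
  · simp [Real.sqrt_sq]
  · ext y
    simp [Real.sqrt_sq]
    ring

theorem hasFDerivAt_comp_norm {v : ℝ → ℝ} {v' : ℝ} {x : F} (hx : x ≠ 0)
    (hv : HasDerivAt v v' ‖x‖) :
    HasFDerivAt (fun y : F => v ‖y‖) ((v' / ‖x‖) • innerSL ℝ x) x := by
  refine (hv.comp_hasFDerivAt x (hasFDerivAt_norm hx)).congr_fderiv ?_
  rw [smul_smul, div_eq_mul_inv]

/-- The norm approaches 0 from the right only, so a one-sided derivative suffices. This handles the
origin, where the chain rule through the norm fails. -/
theorem isLittleO_comp_norm {F : Type*} [NormedAddCommGroup F] {v : ℝ → ℝ} {v' : ℝ}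
    (hv : HasDerivWithinAt v v' (Ici 0) 0) :
    (fun x : F => v ‖x‖ - v 0 - v' * ‖x‖) =o[𝓝 0] fun x : F => x := by
  have h := hv.isLittleO
  have ht : Tendsto (fun x : F => ‖x‖) (𝓝 0) (𝓝[≥] 0) :=
    tendsto_nhdsWithin_iff.2 ⟨tendsto_norm_zero, Eventually.of_forall fun x => norm_nonneg x⟩
  have := (h.comp_tendsto ht).norm_right
  simp only [Function.comp_def, sub_zero, norm_norm] at this
  refine (this.of_norm_right).congr_left fun x => ?_
  simp
  ring

theorem hasFDerivAt_comp_norm_zero {v : ℝ → ℝ} (hv : HasDerivWithinAt v 0 (Ici 0) 0) :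
    HasFDerivAt (fun y : F => v ‖y‖) (0 : F →L[ℝ] ℝ) 0 := by
  refine .of_isLittleO ?_
  simpa using isLittleO_comp_norm (F := F) hv

theorem continuous_radial_smul {d : ℝ → ℝ} (hd : Continuous d) (h0 : d 0 = 0) :
    Continuous fun x : F => (d ‖x‖ / ‖x‖) • x := by
  rw [continuous_iff_continuousAt]
  intro x
  by_cases hx : x = 0
  · subst hx
    have h1 : Tendsto (fun x : F => d ‖x‖) (𝓝 0) (𝓝 0) := by
      have : Continuous fun x : F => d ‖x‖ := by fun_prop
      simpa [h0] using this.tendsto 0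
    have h2 : Tendsto (fun x : F => (d ‖x‖ / ‖x‖) • x) (𝓝 0) (𝓝 0) := by
      refine squeeze_zero_norm (fun y => ?_) (by simpa using h1.norm)
      rcases eq_or_ne y 0 with rfl | hy
      · simp
      · rw [norm_smul, norm_div, norm_norm, div_mul_cancel₀ _ (norm_ne_zero_iff.2 hy)]
        exact le_rfl
    simpa [ContinuousAt] using h2
  · have : ‖x‖ ≠ 0 := norm_ne_zero_iff.2 hx
    have h3 : Continuous fun x : F => d ‖x‖ := by fun_prop
    exact (h3.continuousAt.div continuous_norm.continuousAt this).smul continuousAt_id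

end Radial

/-! ### Monotonicity, truncation and divergence of radial fields -/

/-- The vector field `ξ ↦ |ξ|^{p-2} ξ` is monotone. -/
theorem inner_rpow_smul_sub_nonneg {F : Type*} [NormedAddCommGroup F] [InnerProductSpace ℝ F]
    {p : ℝ} (hp : 1 < p) (ξ η : F) :
    0 ≤ inner ℝ (‖ξ‖ ^ (p - 2) • ξ - ‖η‖ ^ (p - 2) • η) (ξ - η) := by
  have hpow : ∀ t : ℝ, 0 ≤ t → t ^ (p - 2) * t = t ^ (p - 1) := by
    intro t ht
    rcases ht.eq_or_lt with rfl | ht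
    · rw [mul_zero, Real.zero_rpow (by linarith)]
    · rw [← Real.rpow_add_one ht.ne']; ring_nf
  have hc : inner ℝ ξ η ≤ ‖ξ‖ * ‖η‖ := real_inner_le_norm ξ η
  have ha : 0 ≤ ‖ξ‖ ^ (p - 2) := by positivity
  have hb : 0 ≤ ‖η‖ ^ (p - 2) := by positivity
  -- By Cauchy–Schwarz, the inner product is at least this one-dimensional expression in the norms.
  have hmon : 0 ≤ (‖ξ‖ ^ (p - 1) - ‖η‖ ^ (p - 1)) * (‖ξ‖ - ‖η‖) := by
    rcases le_total ‖ξ‖ ‖η‖ with h | h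
    · exact mul_nonneg_of_nonpos_of_nonpos
        (sub_nonpos.2 (Real.rpow_le_rpow (norm_nonneg _) h (by linarith))) (sub_nonpos.2 h)
    · exact mul_nonneg
        (sub_nonneg.2 (Real.rpow_le_rpow (norm_nonneg _) h (by linarith))) (sub_nonneg.2 h)
  rw [← hpow _ (norm_nonneg ξ), ← hpow _ (norm_nonneg η)] at hmon
  have e : inner ℝ (‖ξ‖ ^ (p - 2) • ξ - ‖η‖ ^ (p - 2) • η) (ξ - η)
      = ‖ξ‖ ^ (p - 2) * (‖ξ‖ * ‖ξ‖) + ‖η‖ ^ (p - 2) * (‖η‖ * ‖η‖)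
        - (‖ξ‖ ^ (p - 2) + ‖η‖ ^ (p - 2)) * inner ℝ ξ η := by
    simp only [inner_sub_left, inner_sub_right, real_inner_smul_left,
      real_inner_self_eq_norm_mul_norm, real_inner_comm ξ η]
    ring
  rw [e]
  nlinarith [mul_le_mul_of_nonneg_left hc (add_nonneg ha hb)]

/-- The integral of a directional derivative of a compactly supported function vanishes. -/
theorem integral_fderiv_apply_eq_zero {E : Type*} [NormedAddCommGroup E] [NormedSpace ℝ E]
    [FiniteDimensional ℝ E] [MeasurableSpace E] [BorelSpace E] (μ : Measure E)
    [μ.IsAddHaarMeasure] {h : E → ℝ} (hd : Differentiable ℝ h) (hs : HasCompactSupport h) (e : E)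
    (hi : Integrable (fun x => fderiv ℝ h x e) μ) : ∫ x, fderiv ℝ h x e ∂μ = 0 := by
  have := integral_mul_fderiv_eq_neg_fderiv_mul_of_integrable (μ := μ) (f := fun _ : E => (1 : ℝ))
    (g := h) (v := e) (by simp) (by simpa using hi)
    (by simpa using hd.continuous.integrable_of_hasCompactSupport hs)
    (fun _ _ => differentiableAt_const _) (fun x _ => hd x)
  simpa using this

/-- Squaring removes the corner of the positive part, which is what makes the truncation `(w - v)₊²`
an admissible `C¹` test function. -/
theorem hasDerivAt_max_zero_sq (t : ℝ) :
    HasDerivAt (fun t : ℝ => max t 0 ^ 2) (2 * max t 0) t := by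
  rcases lt_trichotomy t 0 with ht | rfl | ht
  · have : (fun t : ℝ => max t 0 ^ 2) =ᶠ[𝓝 t] fun _ => 0 := by
      filter_upwards [Iio_mem_nhds ht] with s hs
      rw [max_eq_right (mem_Iio.1 hs).le, zero_pow two_ne_zero]
    rw [max_eq_right ht.le, mul_zero]
    exact (hasDerivAt_const t (0 : ℝ)).congr_of_eventuallyEq this
  · rw [max_self, mul_zero, hasDerivAt_iff_isLittleO]
    have h : (fun t : ℝ => t ^ 2) =o[𝓝 0] fun t : ℝ => t := by
      simpa using Asymptotics.isLittleO_pow_pow (𝕜 := ℝ) one_lt_two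
    refine (Asymptotics.IsBigO.of_bound 1 (Eventually.of_forall fun s => ?_)).trans_isLittleO
      (by simpa using h)
    simp only [max_self, ne_eq, OfNat.ofNat_ne_zero, not_false_eq_true, zero_pow, sub_zero,
      smul_zero, one_mul, norm_pow]
    gcongr
    rcases le_total s 0 with h | h <;> simp [h]
  · have : (fun t : ℝ => max t 0 ^ 2) =ᶠ[𝓝 t] fun t => t ^ 2 := by
      filter_upwards [Ioi_mem_nhds ht] with s hs
      rw [max_eq_left (mem_Ioi.1 hs).le]
    rw [max_eq_left ht.le]
    simpa using (hasDerivAt_pow 2 t).congr_of_eventuallyEq this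

/-- Coordinates of a radial vector field `V(|x|) x / |x|`: differentiability, a bound for the
diagonal entries of the differential, and a bound for the divergence. -/
theorem exists_hasFDerivAt_radial_field {N : ℕ} (hN : 0 < N) {R₁ : ℝ} {V q : ℝ → ℝ}
    (hVc : Continuous V) (hV0 : V 0 = 0) (hVn : ∀ r ∈ Ioo 0 R₁, 0 ≤ V r)
    (hV : ∀ r ∈ Ioo 0 R₁, HasDerivAt V (q r) r) (hqc : Continuous q)
    (hqm : MonotoneOn q (Ico 0 R₁)) {x : EuclideanSpace ℝ (Fin N)} (hx : ‖x‖ < R₁) :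
    ∃ L : Fin N → EuclideanSpace ℝ (Fin N) →L[ℝ] ℝ,
      (∀ i, HasFDerivAt (fun y : EuclideanSpace ℝ (Fin N) => V ‖y‖ / ‖y‖ * y i) (L i) x) ∧
      (∀ i, |L i (EuclideanSpace.single i 1)| ≤ 2 * q ‖x‖) ∧
      ∑ i, L i (EuclideanSpace.single i 1) ≤ N * q ‖x‖ := by
  -- Mean value theorem with `V 0 = 0` and `q` nondecreasing; this controls the term `(N-1) V / r`
  -- of the divergence.
  have hVq : ∀ r ∈ Ioo 0 R₁, V r ≤ r * q r := by
    intro r hr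
    obtain ⟨ξ, hξ, hs⟩ := exists_hasDerivAt_eq_slope V q hr.1 hVc.continuousOn
      fun t ht => hV t ⟨ht.1, ht.2.trans hr.2⟩
    have h1 : q ξ ≤ q r := hqm ⟨hξ.1.le, hξ.2.trans hr.2⟩ ⟨hr.1.le, hr.2⟩ hξ.2.le
    rw [hs, hV0, sub_zero, sub_zero, div_le_iff₀ hr.1] at h1
    linarith
  have hproj : ∀ i : Fin N, HasFDerivAt (fun y : EuclideanSpace ℝ (Fin N) => y i)
      (EuclideanSpace.proj (𝕜 := ℝ) i : EuclideanSpace ℝ (Fin N) →L[ℝ] ℝ) x :=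
    fun i => (EuclideanSpace.proj (𝕜 := ℝ) i : EuclideanSpace ℝ (Fin N) →L[ℝ] ℝ).hasFDerivAt
  by_cases hx0 : x = 0
  · subst hx0
    have hR : 0 < R₁ := by simpa using hx
    -- The derivative is given only on the open interval; its limit at 0 supplies the one-sided
    -- derivative there.
    have hd : HasDerivWithinAt V (q 0) (Ici 0) 0 := by
      refine hasDerivWithinAt_Ici_of_tendsto_deriv (s := Ioo 0 R₁)
        (fun t ht => (hV t ht).differentiableAt.differentiableWithinAt)
        hVc.continuousWithinAt (Ioo_mem_nhdsGT hR) ?_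
      refine ((hqc.tendsto 0).mono_left nhdsWithin_le_nhds).congr' ?_
      filter_upwards [Ioo_mem_nhdsGT hR] with t ht using (hV t ht).deriv.symm
    have hq0 : 0 ≤ q 0 := by
      refine ge_of_tendsto ((hqc.tendsto 0).mono_left nhdsWithin_le_nhds : Tendsto q (𝓝[>] 0) _) ?_
      filter_upwards [Ioo_mem_nhdsGT hR] with t ht
      exact nonneg_of_mul_nonneg_right ((hVn t ht).trans (hVq t ht)) ht.1
    refine ⟨fun i => q 0 • EuclideanSpace.proj (𝕜 := ℝ) i, fun i => ?_, fun i => ?_, ?_⟩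
    · refine .of_isLittleO ?_
      have h := (isLittleO_comp_norm (F := EuclideanSpace ℝ (Fin N)) hd)
      refine (Asymptotics.IsBigO.of_bound 1 (Eventually.of_forall fun y => ?_)).trans_isLittleO
        (by simpa using h)
      by_cases hy : y = 0
      · simp [hy]
      have hy' : 0 < ‖y‖ := norm_pos_iff.2 hy
      have hyi : |y i| ≤ ‖y‖ := by simpa using PiLp.norm_apply_le y i
      have e : V ‖y‖ / ‖y‖ * y i - q 0 * y i = (V ‖y‖ - q 0 * ‖y‖) * (y i / ‖y‖) := by
        field_simp
      simp only [norm_zero, PiLp.zero_apply, mul_zero, sub_zero, hV0,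
        _root_.smul_apply, smul_eq_mul, one_mul]
      change ‖V ‖y‖ / ‖y‖ * y i - q 0 * y i‖ ≤ _
      rw [e, norm_mul]
      refine mul_le_of_le_one_right (norm_nonneg _) ?_
      rw [Real.norm_eq_abs, abs_div, abs_of_pos hy', div_le_one hy']
      exact hyi
    · simp [abs_of_nonneg hq0]; linarith
    · simp
  · have hr : 0 < ‖x‖ := norm_pos_iff.2 hx0
    have hmem : ‖x‖ ∈ Ioo 0 R₁ := ⟨hr, hx⟩
    set r := ‖x‖ with hrdef
    have hm := (hV r hmem).div (hasDerivAt_id r) hr.ne'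
    refine ⟨fun i => (V ‖x‖ / ‖x‖) • (EuclideanSpace.proj (𝕜 := ℝ) i) +
        x i • ((q r * id r - V r * 1) / id r ^ 2 / ‖x‖) • innerSL ℝ x,
      fun i => (hasFDerivAt_comp_norm hx0 hm).mul (hproj i), ?_⟩
    -- Each diagonal entry is a convex combination of `V r / r` and `q r`, hence lies in `[0, q r]`;
    -- their sum is `q + (N-1) V / r`.
    have hL : ∀ i, ((V ‖x‖ / ‖x‖) • (EuclideanSpace.proj (𝕜 := ℝ) i) +
        x i • ((q r * id r - V r * 1) / id r ^ 2 / ‖x‖) • innerSL ℝ x)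
          (EuclideanSpace.single i (1 : ℝ)) = V r / r + (q r - V r / r) * (x i ^ 2 / r ^ 2) := by
      intro i
      simp [EuclideanSpace.inner_single_right]
      rw [← hrdef]
      field_simp
    have hμ : V r / r ≤ q r := by rw [div_le_iff₀ hr]; linarith [hVq r hmem]
    have hμ0 : 0 ≤ V r / r := div_nonneg (hVn r hmem) hr.le
    have hsum : ∑ i, x i ^ 2 = r ^ 2 := by
      rw [hrdef, EuclideanSpace.norm_sq_eq]; simp
    constructor
    · intro i
      have h1 : x i ^ 2 / r ^ 2 ≤ 1 := by
        rw [div_le_one (by positivity), ← hsum]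
        exact Finset.single_le_sum (f := fun i => x i ^ 2) (fun _ _ => sq_nonneg _)
          (Finset.mem_univ i)
      have h0 : 0 ≤ x i ^ 2 / r ^ 2 := by positivity
      simp only [hL]
      rw [abs_of_nonneg (by nlinarith)]
      nlinarith
    · simp only [hL]
      have hs1 : ∑ i, x i ^ 2 / r ^ 2 = 1 := by
        rw [← Finset.sum_div, hsum, div_self (by positivity)]
      rw [Finset.sum_add_distrib, ← Finset.mul_sum, hs1]
      simp
      have : (1 : ℝ) ≤ N := by exact_mod_cast hN
      nlinarith

theorem continuous_rpow_norm_smul {F : Type*} [NormedAddCommGroup F] [NormedSpace ℝ F] {p : ℝ}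
    (hp : 2 ≤ p) : Continuous fun ξ : F => ‖ξ‖ ^ (p - 2) • ξ :=
  (continuous_norm.rpow_const fun _ => Or.inr (by linarith)).smul continuous_id

theorem continuous_gradient {F : Type*} [NormedAddCommGroup F] [InnerProductSpace ℝ F]
    [CompleteSpace F] {u : F → ℝ} (hu : ContDiff ℝ 1 u) : Continuous (gradient u) :=
  (InnerProductSpace.toDual ℝ F).symm.continuous.comp (hu.continuous_fderiv one_ne_zero)

theorem contDiff_one_of_hasGradientAt {F : Type*} [NormedAddCommGroup F] [InnerProductSpace ℝ F]
    [CompleteSpace F] {u : F → ℝ} {D : F → F} (h : ∀ x, HasGradientAt u (D x) x)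
    (hD : Continuous D) : ContDiff ℝ 1 u := by
  rw [contDiff_one_iff_fderiv]
  refine ⟨fun x => (h x).differentiableAt, ?_⟩
  have : fderiv ℝ u = fun x => InnerProductSpace.toDual ℝ F (D x) :=
    funext fun x => (h x).hasFDerivAt.fderiv
  rw [this]
  exact (InnerProductSpace.toDual ℝ F).continuous.comp hD

/-! ### Comparison principle -/

/-- Comparison of a `C¹` subsolution `w` of `Δ_p w ≥ g(w)` with a radial supersolution lying above
`w` on a sphere. -/
theorem subsolution_apply_zero_le {N : ℕ} (hN : 0 < N) {p a c R₁ M : ℝ} (hp : 2 ≤ p)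
    {g v d : ℝ → ℝ} (ha : 0 < a) (hc : 0 < c) (hcN : N * c ≤ 1 / 2) (hgc : Continuous g)
    (hg : ∀ s, 0 < s → 0 < g s) (hgm : MonotoneOn g (Ioi 0)) (hR : 0 < R₁)
    (hvc : Continuous v) (hvm : StrictMono v) (hv0 : v 0 = a) (hvM : v R₁ = M)
    (hdc : Continuous d) (hd0 : d 0 = 0)
    (hvd : ∀ r ∈ Ioo 0 R₁, 0 < d r ∧ HasDerivAt v (d r) r ∧
      HasDerivAt (fun r => d r ^ (p - 1)) (c * g (v r)) r)
    {w : EuclideanSpace ℝ (Fin N) → ℝ} (hw : ContDiff ℝ 1 w)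
    (hwM : ∀ x, ‖x‖ ≤ R₁ → w x < M)
    (hsub : ∀ φ : EuclideanSpace ℝ (Fin N) → ℝ, ContDiff ℝ 1 φ → HasCompactSupport φ →
      (∀ x, 0 ≤ φ x) → ∫ x, g (w x) * φ x ≤
        -∫ x, inner ℝ (‖gradient w x‖ ^ (p - 2) • gradient w x) (gradient φ x)) :
    w 0 ≤ a := by
  by_contra! hwa
  set m : EuclideanSpace ℝ (Fin N) → ℝ := fun x => max (w x - v ‖x‖) 0 with hm
  set Y : EuclideanSpace ℝ (Fin N) → EuclideanSpace ℝ (Fin N) := fun x => (d ‖x‖ / ‖x‖) • x with hY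
  -- Test function `(w - v)₊²`, extended by zero. It is `C¹` across the sphere because `w < M = v`
  -- there, so it already vanishes nearby (`hout`).
  set φ : EuclideanSpace ℝ (Fin N) → ℝ := fun x =>
    if ‖x‖ < R₁ then m x ^ 2 else 0 with hφ
  set D : EuclideanSpace ℝ (Fin N) → EuclideanSpace ℝ (Fin N) := fun x =>
    if ‖x‖ < R₁ then (2 * m x) • (gradient w x - Y x) else 0 with hD
  have hwc : Continuous w := hw.continuous
  have hgw : Continuous (gradient w) := continuous_gradient hw
  have hYc : Continuous Y := continuous_radial_smul hdc hd0
  have hmc : Continuous m := by fun_prop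
  have hge : ∀ x : EuclideanSpace ℝ (Fin N), a ≤ v ‖x‖ := fun x =>
    hv0 ▸ hvm.monotone (norm_nonneg x)
  have hball : ∀ x : EuclideanSpace ℝ (Fin N), ‖x‖ < R₁ → ∀ᶠ y in 𝓝 x, ‖y‖ < R₁ :=
    fun x hx => continuous_norm.continuousAt.eventually_lt continuousAt_const hx
  have hout : ∀ x : EuclideanSpace ℝ (Fin N), R₁ ≤ ‖x‖ → ∀ᶠ y in 𝓝 x, φ y = 0 ∧ D y = 0 := by
    intro x hx
    have : ∀ᶠ y in 𝓝 x, ‖y‖ < R₁ → w y < v ‖y‖ := by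
      rcases hx.eq_or_lt with hx | hx
      · have h1 : w x < v ‖x‖ := by rw [← hx, hvM]; exact hwM x hx.ge
        have h2 : Continuous fun y : EuclideanSpace ℝ (Fin N) => v ‖y‖ := by fun_prop
        filter_upwards [hwc.continuousAt.eventually_lt h2.continuousAt h1] with y hy _ using hy
      · filter_upwards [continuousAt_const.eventually_lt continuous_norm.continuousAt hx]
          with y hy hy'
        exact absurd hy' hy.le.not_gt
    filter_upwards [this] with y hy
    by_cases hyR : ‖y‖ < R₁
    · have : m y = 0 := max_eq_right (sub_nonpos.2 (hy hyR).le)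
      simp [hφ, hD, this]
    · simp [hφ, hD, hyR]
  -- the differential of the comparison function
  have hy : ∀ x : EuclideanSpace ℝ (Fin N), ‖x‖ < R₁ →
      HasGradientAt (fun y : EuclideanSpace ℝ (Fin N) => v ‖y‖) (Y x) x := by
    intro x hx
    rw [hasGradientAt_iff_hasFDerivAt]
    by_cases hx0 : x = 0
    · subst hx0
      have : HasDerivWithinAt v 0 (Ici 0) 0 := by
        refine hasDerivWithinAt_Ici_of_tendsto_deriv (s := Ioo 0 R₁)
          (fun t ht => (hvd t ht).2.1.differentiableAt.differentiableWithinAt)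
          hvc.continuousWithinAt (Ioo_mem_nhdsGT hR) ?_
        have h0 := (hdc.tendsto 0).mono_left (nhdsWithin_le_nhds (s := Ioi 0))
        rw [hd0] at h0
        refine h0.congr' ?_
        filter_upwards [Ioo_mem_nhdsGT hR] with t ht using (hvd t ht).2.1.deriv.symm
      simpa [hY] using hasFDerivAt_comp_norm_zero (F := (EuclideanSpace ℝ (Fin N))) this
    · refine (hasFDerivAt_comp_norm hx0 (hvd _ ⟨norm_pos_iff.2 hx0, hx⟩).2.1).congr_fderiv ?_
      ext z
      simp [hY]
  have hφd : ∀ x, HasGradientAt φ (D x) x := by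
    intro x
    rw [hasGradientAt_iff_hasFDerivAt]
    by_cases hx : ‖x‖ < R₁
    · have h1 : HasFDerivAt (fun y => w y - v ‖y‖)
          (InnerProductSpace.toDual ℝ _ (gradient w x) - InnerProductSpace.toDual ℝ _ (Y x)) x :=
        ((hw.differentiable one_ne_zero x).hasGradientAt.hasFDerivAt).sub (hy x hx).hasFDerivAt
      have h2 := (hasDerivAt_max_zero_sq _).comp_hasFDerivAt x h1
      have h3 : φ =ᶠ[𝓝 x] fun y => max (w y - v ‖y‖) 0 ^ 2 := by
        filter_upwards [hball x hx] with y hy'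
        simp [hφ, hm, hy']
      refine (h2.congr_of_eventuallyEq h3).congr_fderiv ?_
      simp [hD, hx, hm]
    · have h3 : φ =ᶠ[𝓝 x] fun _ => 0 := (hout x (not_lt.1 hx)).mono fun y h => h.1
      simpa [hD, hx] using (hasFDerivAt_const (0 : ℝ) x).congr_of_eventuallyEq h3
  have hDc : Continuous D := by
    rw [continuous_iff_continuousAt]
    intro x
    by_cases hx : ‖x‖ < R₁
    · have h3 : (fun y => (2 * m y) • (gradient w y - Y y)) =ᶠ[𝓝 x] D := by
        filter_upwards [hball x hx] with y hy'
        simp [hD, hy']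
      exact ContinuousAt.congr (by fun_prop) h3
    · have h3 : (fun _ => 0) =ᶠ[𝓝 x] D := (hout x (not_lt.1 hx)).mono fun y h => h.2.symm
      exact ContinuousAt.congr continuousAt_const h3
  have hφC : ContDiff ℝ 1 φ := contDiff_one_of_hasGradientAt hφd hDc
  have hφc : Continuous φ := hφC.continuous
  have hcpt : ∀ {G : Type} [Zero G] (h : EuclideanSpace ℝ (Fin N) → G),
      (∀ x, R₁ ≤ ‖x‖ → h x = 0) →
      HasCompactSupport h := by
    intro G _ h hh
    refine HasCompactSupport.intro (isCompact_closedBall (0 : EuclideanSpace ℝ (Fin N)) R₁)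
      fun x hx => hh x ?_
    simpa using (le_of_lt (by simpa using hx : R₁ < ‖x‖))
  have hφout : ∀ x, R₁ ≤ ‖x‖ → φ x = 0 := fun x hx => by simp [hφ, hx.not_gt]
  have hDout : ∀ x, R₁ ≤ ‖x‖ → D x = 0 := fun x hx => by simp [hD, hx.not_gt]
  have hφs : HasCompactSupport φ := hcpt φ hφout
  have hφn : ∀ x, 0 ≤ φ x := fun x => by
    simp only [hφ]; split_ifs <;> positivity
  have hφpos : ∀ x, φ x ≠ 0 → ‖x‖ < R₁ ∧ v ‖x‖ < w x := by
    intro x hx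
    by_cases h : ‖x‖ < R₁
    · refine ⟨h, ?_⟩
      by_contra! h'
      exact hx (by simp [hφ, h, hm, h'])
    · exact absurd (hφout x (not_lt.1 h)) hx
  have key := hsub φ hφC hφs hφn
  rw [gradient_eq hφd] at key
  -- the flux of the radial supersolution
  set V : ℝ → ℝ := fun r => d r ^ (p - 1) with hV
  have hVc : Continuous V := hdc.rpow_const fun _ => Or.inr (by linarith)
  have hV0 : V 0 = 0 := by
    simp only [hV, hd0]; exact Real.zero_rpow (by linarith)
  have hflux : ∀ x : EuclideanSpace ℝ (Fin N), ‖x‖ < R₁ → ∀ i,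
      (‖Y x‖ ^ (p - 2) • Y x) i = V ‖x‖ / ‖x‖ * x i := by
    intro x hx i
    by_cases hx0 : x = 0
    · simp [hY, hx0]
    · have hr : 0 < ‖x‖ := norm_pos_iff.2 hx0
      have hdr : 0 < d ‖x‖ := (hvd _ ⟨hr, hx⟩).1
      have hn : ‖Y x‖ = d ‖x‖ := by
        simp only [hY]
        rw [norm_smul, Real.norm_of_nonneg (div_nonneg hdr.le hr.le), div_mul_cancel₀ _ hr.ne']
      rw [hn]
      simp only [hY, hV, PiLp.smul_apply, smul_eq_mul]
      have : d ‖x‖ ^ (p - 1) = d ‖x‖ ^ (p - 2) * d ‖x‖ := by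
        rw [← Real.rpow_add_one hdr.ne']; ring_nf
      rw [this]; ring
  have hqm : MonotoneOn (fun r => c * g (v r)) (Ico 0 R₁) := by
    intro r hr s hs hrs
    have h1 : ∀ t, 0 ≤ t → v t ∈ Ioi (0 : ℝ) := fun t ht =>
      ha.trans_le (hv0 ▸ hvm.monotone ht)
    exact mul_le_mul_of_nonneg_left (hgm (h1 r hr.1) (h1 s hs.1) (hvm.monotone hrs)) hc.le
  have hdiv := fun (x : EuclideanSpace ℝ (Fin N)) (hx : ‖x‖ < R₁) => exists_hasFDerivAt_radial_field
    hN hVc hV0 (fun r hr => Real.rpow_nonneg (hvd r hr).1.le _) (fun r hr => (hvd r hr).2.2)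
    (continuous_const.mul (hgc.comp hvc)) hqm hx
  choose! L hL1 hL2 hL3 using hdiv
  set X : Fin N → EuclideanSpace ℝ (Fin N) → ℝ := fun i y => V ‖y‖ / ‖y‖ * y i with hX
  have hXc : ∀ i, Continuous (X i) := by
    intro i
    have h1 := (EuclideanSpace.proj (𝕜 := ℝ) i : EuclideanSpace ℝ (Fin N) →L[ℝ] ℝ).continuous.comp
      (continuous_radial_smul (F := (EuclideanSpace ℝ (Fin N))) hVc hV0)
    exact h1.congr fun y => by simp [hX]
  have hhd : ∀ i x, HasFDerivAt (fun y => φ y * X i y)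
      (φ x • (if ‖x‖ < R₁ then L x i else 0) + X i x • InnerProductSpace.toDual ℝ _ (D x)) x := by
    intro i x
    by_cases hx : ‖x‖ < R₁
    · rw [if_pos hx]
      exact (hφd x).hasFDerivAt.mul (hL1 x hx i)
    · have h3 : (fun y => φ y * X i y) =ᶠ[𝓝 x] fun _ => 0 :=
        (hout x (not_lt.1 hx)).mono fun y h => by simp [h.1]
      simpa [hx, hDout x (not_lt.1 hx)] using
        (hasFDerivAt_const (0 : ℝ) x).congr_of_eventuallyEq h3
  set e : Fin N → EuclideanSpace ℝ (Fin N) := fun i => EuclideanSpace.single i 1 with he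
  have hfd : ∀ i x, fderiv ℝ (fun y => φ y * X i y) x (e i)
      = φ x * (if ‖x‖ < R₁ then L x i (e i) else 0) + X i x * D x i := by
    intro i x
    rw [(hhd i x).fderiv]
    by_cases hx : ‖x‖ < R₁ <;> simp [hx, he, EuclideanSpace.inner_single_right]
  have hDi : ∀ i, Continuous fun x => D x i := fun i =>
    (EuclideanSpace.proj (𝕜 := ℝ) i : EuclideanSpace ℝ (Fin N) →L[ℝ] ℝ).continuous.comp hDc
  -- No continuity of the partial derivatives of the flux is available, so integrability comes from
  -- measurability of `fderiv` and the bound by `2 * q`.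
  have hhint : ∀ i, Integrable fun x => fderiv ℝ (fun y => φ y * X i y) x (e i) := by
    intro i
    have hb : Continuous fun x => φ x * (2 * (c * g (v ‖x‖))) + |X i x * D x i| :=
      (hφc.mul (by fun_prop)).add ((hXc i).mul (hDi i)).abs
    refine Integrable.mono' (hb.integrable_of_hasCompactSupport
      (hcpt _ fun x hx => by simp [hφout x hx, hDout x hx]))
      (measurable_fderiv_apply_const ℝ _ _).aestronglyMeasurable (Eventually.of_forall fun x => ?_)
    rw [hfd, Real.norm_eq_abs]
    refine (abs_add_le _ _).trans (add_le_add_left ?_ _)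
    by_cases hx : ‖x‖ < R₁
    · rw [if_pos hx, abs_mul, abs_of_nonneg (hφn x)]
      exact mul_le_mul_of_nonneg_left (hL2 x hx i) (hφn x)
    · simp [hφout x (not_lt.1 hx)]
  have hzero : ∀ i, ∫ x, fderiv ℝ (fun y => φ y * X i y) x (e i) = 0 := fun i =>
    integral_fderiv_apply_eq_zero volume (fun x => (hhd i x).differentiableAt)
      (hcpt _ fun x hx => by simp [hφout x hx]) (e i) (hhint i)
  have hAc := continuous_rpow_norm_smul (F := (EuclideanSpace ℝ (Fin N))) hp
  have hAY : Continuous fun x => ‖Y x‖ ^ (p - 2) • Y x := hAc.comp hYc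
  have hAw : Continuous fun x => ‖gradient w x‖ ^ (p - 2) • gradient w x := hAc.comp hgw
  have i1 : Integrable fun x => inner ℝ (‖Y x‖ ^ (p - 2) • Y x) (D x) :=
    (hAY.inner hDc).integrable_of_hasCompactSupport (hcpt _ fun x hx => by simp [hDout x hx])
  have i2 : Integrable fun x => inner ℝ (‖gradient w x‖ ^ (p - 2) • gradient w x) (D x) :=
    (hAw.inner hDc).integrable_of_hasCompactSupport (hcpt _ fun x hx => by simp [hDout x hx])
  have hgφc : Continuous fun x => g (w x) * φ x := (hgc.comp hwc).mul hφc
  have hgφs : HasCompactSupport fun x => g (w x) * φ x := hcpt _ fun x hx => by simp [hφout x hx]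
  have i3 : Integrable fun x => g (w x) * φ x := hgφc.integrable_of_hasCompactSupport hgφs
  -- This is `div (φ X) = φ div X + X · ∇φ`. Where `φ ≠ 0` one has `v < w`, so `div X ≤ N c g(v) ≤
  -- g(w) / 2`.
  have hpw : ∀ x, ∑ i, fderiv ℝ (fun y => φ y * X i y) x (e i) ≤
      1 / 2 * (g (w x) * φ x) + inner ℝ (‖Y x‖ ^ (p - 2) • Y x) (D x) := by
    intro x
    by_cases hx : ‖x‖ < R₁
    · simp only [hfd, if_pos hx, Finset.sum_add_distrib]
      refine add_le_add ?_ (le_of_eq ?_)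
      · rw [← Finset.mul_sum]
        by_cases h0 : φ x = 0
        · simp [h0]
        have hlt := (hφpos x h0).2
        have hvp : 0 < v ‖x‖ := ha.trans_le (hge x)
        have h1 : g (v ‖x‖) ≤ g (w x) := hgm hvp (hvp.trans hlt) hlt.le
        have h2 : ∑ i, L x i (e i) ≤ 1 / 2 * g (w x) := by
          refine (hL3 x hx).trans ?_
          have := hg _ hvp
          calc (N : ℝ) * (c * g (v ‖x‖)) = (N * c) * g (v ‖x‖) := by ring
            _ ≤ 1 / 2 * g (v ‖x‖) := mul_le_mul_of_nonneg_right hcN this.le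
            _ ≤ _ := by linarith
        nlinarith [mul_le_mul_of_nonneg_left h2 (hφn x)]
      · rw [PiLp.inner_apply]
        refine Finset.sum_congr rfl fun i _ => ?_
        rw [hflux x hx i]
        simp [hX, mul_comm]
    · simp [hfd, hφout x (not_lt.1 hx), hDout x (not_lt.1 hx)]
  have h1 : 0 ≤ 1 / 2 * (∫ x, g (w x) * φ x) + ∫ x, inner ℝ (‖Y x‖ ^ (p - 2) • Y x) (D x) := by
    have h2 := integral_mono (integrable_finsetSum Finset.univ fun i _ => hhint i)
      ((i3.const_mul (1 / 2)).add i1) hpw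
    rw [integral_finsetSum _ fun i _ => hhint i] at h2
    simp only [hzero, Finset.sum_const_zero, Pi.add_apply] at h2
    rwa [integral_add (i3.const_mul _) i1, integral_const_mul] at h2
  have h2 : 0 ≤ (∫ x, inner ℝ (‖gradient w x‖ ^ (p - 2) • gradient w x) (D x)) -
      ∫ x, inner ℝ (‖Y x‖ ^ (p - 2) • Y x) (D x) := by
    rw [← integral_sub i2 i1]
    refine integral_nonneg fun x => ?_
    simp only [Pi.zero_apply]
    rw [← inner_sub_left]
    by_cases hx : ‖x‖ < R₁
    · simp only [hD, if_pos hx, real_inner_smul_right]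
      exact mul_nonneg (mul_nonneg two_pos.le (le_max_right _ _))
        (inner_rpow_smul_sub_nonneg (by linarith) _ _)
    · simp [hDout x (not_lt.1 hx)]
  have h3 : 0 < ∫ x, g (w x) * φ x := by
    refine hgφc.integral_pos_of_hasCompactSupport_nonneg_nonzero hgφs (x := 0) (fun x => ?_) ?_
    · by_cases h0 : φ x = 0
      · simp [h0]
      · exact mul_nonneg (hg _ ((ha.trans_le (hge x)).trans (hφpos x h0).2)).le (hφn x)
    · refine mul_ne_zero (hg _ (ha.trans hwa)).ne' ?_
      simpa [hφ, hm, hR, hv0] using hwa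
  -- Together, `∫ g(w) φ ≤ -∫ A(∇w)·D ≤ -∫ A(Y)·D ≤ ½ ∫ g(w) φ` with `A(ξ) = |ξ|^(p-2) ξ`, against
  -- positivity of `∫ g(w) φ`. The factor ½ dispenses with strict monotonicity.
  linarith

/-! ### Liouville property for `p ≥ N` -/

theorem norm_gradient {F : Type*} [NormedAddCommGroup F] [InnerProductSpace ℝ F]
    [CompleteSpace F] (u : F → ℝ) (x : F) : ‖gradient u x‖ = ‖fderiv ℝ u x‖ :=
  (InnerProductSpace.toDual ℝ F).symm.norm_map _

/-- If `2pb ≤ a`, the first term on the right dominates; otherwise replacing `a` by `2pb` gives half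
of the second. The constant is crude, but only its finiteness matters. -/
theorem young_absorb {p a b : ℝ} (hp : 1 < p) (ha : 0 ≤ a) (hb : 0 ≤ b) :
    p * a ^ (p - 1) * b ≤ 1 / 2 * a ^ p + (2 * p) ^ p * b ^ p := by
  have hp0 : 0 < p := by linarith
  have hpow : ∀ t : ℝ, 0 ≤ t → t ^ p = t ^ (p - 1) * t := by
    intro t ht
    rcases ht.eq_or_lt with rfl | ht
    · rw [mul_zero, Real.zero_rpow hp0.ne']
    · rw [← Real.rpow_add_one ht.ne']; ring_nf
  have ha1 : 0 ≤ a ^ (p - 1) := Real.rpow_nonneg ha _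
  rcases le_total (2 * p * b) a with h | h
  · have h1 : 0 ≤ (2 * p) ^ p * b ^ p := by positivity
    rw [hpow a ha]
    nlinarith [mul_le_mul_of_nonneg_left h ha1]
  · have h1 : a ^ (p - 1) ≤ (2 * p * b) ^ (p - 1) := Real.rpow_le_rpow ha h (by linarith)
    have h2 : 0 ≤ a ^ p := Real.rpow_nonneg ha _
    rw [← Real.mul_rpow (by positivity) hb, hpow (2 * p * b) (by positivity)]
    have h3 : 0 ≤ (2 * p * b) ^ (p - 1) := by positivity
    have h4 : 0 ≤ p * b := by positivity
    nlinarith [mul_le_mul_of_nonneg_right h1 h4, mul_nonneg h3 h4]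

/-- Logarithmic Caccioppoli inequality for nonnegative `p`-superharmonic functions. -/
theorem integral_log_gradient_le {N : ℕ} {p : ℝ} (hp : 2 ≤ p)
    {u ζ : EuclideanSpace ℝ (Fin N) → ℝ} (hu : ContDiff ℝ 1 u) (hu0 : ∀ x, 0 ≤ u x)
    (hsup : ∀ φ : EuclideanSpace ℝ (Fin N) → ℝ, ContDiff ℝ 1 φ → HasCompactSupport φ →
      (∀ x, 0 ≤ φ x) →
        0 ≤ ∫ x, inner ℝ (‖gradient u x‖ ^ (p - 2) • gradient u x) (gradient φ x))
    (hζ : ContDiff ℝ 1 ζ) (hζs : HasCompactSupport ζ) (hζ0 : ∀ x, 0 ≤ ζ x) :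
    ∫ x, (‖gradient u x‖ / (u x + 1) * ζ x) ^ p ≤
      2 * (2 * p) ^ p * ∫ x, ‖gradient ζ x‖ ^ p := by
  have hp0 : 0 < p := by linarith
  have hz : ∀ x, 0 < u x + 1 := fun x => by linarith [hu0 x]
  -- The exponent `1 - p` makes the flux paired with `∇φ` produce `(1-p) |∇ log (u+1)|^p ζ^p`; the
  -- shift by 1 keeps the base positive where `u` vanishes.
  set φ : EuclideanSpace ℝ (Fin N) → ℝ := fun x => (u x + 1) ^ (1 - p) * ζ x ^ p with hφ
  have hφC : ContDiff ℝ 1 φ :=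
    ((hu.add contDiff_const).rpow_const_of_ne fun x => (hz x).ne').mul
      (by exact_mod_cast hζ.rpow_const_of_le (m := 1) (by norm_num; linarith))
  have hζp : HasCompactSupport fun x => ζ x ^ p :=
    hζs.comp_left (g := fun t : ℝ => t ^ p) (Real.zero_rpow hp0.ne')
  have key := hsup φ hφC hζp.mul_left fun x =>
    mul_nonneg (Real.rpow_nonneg (hz x).le _) (Real.rpow_nonneg (hζ0 x) _)
  have hgrad : ∀ x, gradient φ x = ((1 - p) * (u x + 1) ^ (-p) * ζ x ^ p) • gradient u x +
      ((u x + 1) ^ (1 - p) * (p * ζ x ^ (p - 1))) • gradient ζ x := by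
    intro x
    refine HasGradientAt.gradient (hasGradientAt_iff_hasFDerivAt.2 ?_)
    have h1 : HasFDerivAt (fun y => u y + 1) (fderiv ℝ u x) x :=
      (hu.differentiable one_ne_zero x).hasFDerivAt.add_const 1
    have h2 := h1.rpow_const (p := 1 - p) (Or.inl (hz x).ne')
    have h3 := (hζ.differentiable one_ne_zero x).hasFDerivAt.rpow_const (p := p)
      (Or.inr (by linarith))
    refine (h2.mul h3).congr_fderiv ?_
    ext y
    simp
    ring
  set T : EuclideanSpace ℝ (Fin N) → ℝ := fun x => ‖gradient u x‖ / (u x + 1) with hT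
  have hT0 : ∀ x, 0 ≤ T x := fun x => div_nonneg (norm_nonneg _) (hz x).le
  have hpw : ∀ x, inner ℝ (‖gradient u x‖ ^ (p - 2) • gradient u x) (gradient φ x) ≤
      (2 * p) ^ p * ‖gradient ζ x‖ ^ p - 1 / 2 * (T x * ζ x) ^ p := by
    intro x
    have hG : 0 ≤ ‖gradient u x‖ := norm_nonneg _
    set G := ‖gradient u x‖ with hGdef
    set z := u x + 1 with hzdef
    have hzx : 0 < z := hz x
    have e1 : G ^ (p - 2) * G = G ^ (p - 1) := by
      rcases hG.eq_or_lt with h | h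
      · rw [← h, mul_zero, Real.zero_rpow (by linarith)]
      · rw [← Real.rpow_add_one h.ne']; ring_nf
    have e2 : G ^ (p - 1) * G = G ^ p := by
      rcases hG.eq_or_lt with h | h
      · rw [← h, mul_zero, Real.zero_rpow (by linarith)]
      · rw [← Real.rpow_add_one h.ne']; ring_nf
    have e3 : (T x * ζ x) ^ p = G ^ p * z ^ (-p) * ζ x ^ p := by
      rw [Real.mul_rpow (hT0 x) (hζ0 x), Real.div_rpow hG hzx.le, Real.rpow_neg hzx.le,
        div_eq_mul_inv]
    have e4 : (T x * ζ x) ^ (p - 1) = G ^ (p - 1) * z ^ (1 - p) * ζ x ^ (p - 1) := by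
      rw [Real.mul_rpow (hT0 x) (hζ0 x), Real.div_rpow hG hzx.le,
        show 1 - p = -(p - 1) by ring, Real.rpow_neg hzx.le, div_eq_mul_inv]
    have hy := young_absorb (p := p) (by linarith) (mul_nonneg (hT0 x) (hζ0 x))
      (norm_nonneg (gradient ζ x))
    have hc : inner ℝ (gradient u x) (gradient ζ x) ≤ G * ‖gradient ζ x‖ :=
      real_inner_le_norm _ _
    have h0 : 0 ≤ G ^ (p - 2) * (z ^ (1 - p) * (p * ζ x ^ (p - 1))) := by
      have := hζ0 x
      positivity
    have h1 : 0 ≤ (T x * ζ x) ^ p := Real.rpow_nonneg (mul_nonneg (hT0 x) (hζ0 x)) _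
    calc inner ℝ (G ^ (p - 2) • gradient u x) (gradient φ x)
        = (1 - p) * (((G ^ (p - 2) * G) * G) * z ^ (-p) * ζ x ^ p) +
          G ^ (p - 2) * (z ^ (1 - p) * (p * ζ x ^ (p - 1))) *
            inner ℝ (gradient u x) (gradient ζ x) := by
          rw [hgrad]
          simp only [inner_add_right, real_inner_smul_left, real_inner_smul_right,
            real_inner_self_eq_norm_mul_norm]
          rw [← hGdef]
          ring
      _ ≤ (1 - p) * (((G ^ (p - 2) * G) * G) * z ^ (-p) * ζ x ^ p) +
          G ^ (p - 2) * (z ^ (1 - p) * (p * ζ x ^ (p - 1))) * (G * ‖gradient ζ x‖) := by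
          gcongr
      _ = (1 - p) * (T x * ζ x) ^ p + p * (T x * ζ x) ^ (p - 1) * ‖gradient ζ x‖ := by
          rw [e1, e2, e3, e4, ← e1]; ring
      -- After Young's inequality the coefficient of `(T ζ)^p` is `1 - p + 1/2 ≤ -1/2`, since `p ≥
      -- 2`.
      _ ≤ _ := by nlinarith
  have cu := continuous_gradient hu
  have cζ := continuous_gradient hζ
  have hζgs : HasCompactSupport (gradient ζ) :=
    hζs.fderiv (𝕜 := ℝ) |>.comp_left (map_zero (InnerProductSpace.toDual ℝ _).symm)
  have i1 : Integrable fun x => ‖gradient ζ x‖ ^ p := by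
    refine Continuous.integrable_of_hasCompactSupport
      (cζ.norm.rpow_const fun _ => Or.inr hp0.le) ?_
    exact hζgs.comp_left (g := fun v => ‖v‖ ^ p) (by simp [hp0.ne'])
  have hTc : Continuous T := cu.norm.div (hu.continuous.add continuous_const) fun x => (hz x).ne'
  have i2 : Integrable fun x => (T x * ζ x) ^ p := by
    refine Continuous.integrable_of_hasCompactSupport
      ((hTc.mul hζ.continuous).rpow_const fun _ => Or.inr hp0.le) ?_
    exact (hζs.mul_left (f := T)).comp_left (g := fun t : ℝ => t ^ p) (Real.zero_rpow hp0.ne')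
  have hφgs : HasCompactSupport (gradient φ) :=
    (hζp.mul_left (f := fun x => (u x + 1) ^ (1 - p))).fderiv (𝕜 := ℝ) |>.comp_left
      (map_zero (InnerProductSpace.toDual ℝ _).symm)
  have i3 : Integrable fun x =>
      inner ℝ (‖gradient u x‖ ^ (p - 2) • gradient u x) (gradient φ x) := by
    refine Continuous.integrable_of_hasCompactSupport
      (((continuous_rpow_norm_smul hp).comp cu).inner (continuous_gradient hφC)) ?_
    refine hφgs.mono fun x hx => ?_
    contrapose! hx
    simp only [Function.mem_support, not_not] at hx ⊢
    rw [hx, inner_zero_right]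
  have := integral_mono i3 ((i1.const_mul ((2 * p) ^ p)).sub (i2.const_mul (1 / 2))) hpw
  simp only [Pi.sub_apply] at this
  rw [integral_sub (i1.const_mul _) (i2.const_mul _), integral_const_mul, integral_const_mul]
    at this
  linarith

/-- For `p ≥ N`, balls of `ℝ^N` have vanishing `p`-capacity: averages of dilated bump functions
are cutoff functions of small energy. -/
theorem exists_cutoff_small_energy {N : ℕ} {p : ℝ} (hp : 1 < p) (hNp : (N : ℝ) ≤ p) {ρ : ℝ}
    (hρ : 0 < ρ) : ∃ C : ℝ, ∀ k : ℕ, 0 < k → ∃ ζ : EuclideanSpace ℝ (Fin N) → ℝ,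
      ContDiff ℝ 1 ζ ∧ HasCompactSupport ζ ∧ (∀ x, 0 ≤ ζ x) ∧ (∀ x, ‖x‖ ≤ ρ → ζ x = 1) ∧
        ∫ x, ‖gradient ζ x‖ ^ p ≤ C * (k : ℝ) ^ (1 - p) := by
  have hp0 : 0 < p := by linarith
  let η : ContDiffBump (0 : EuclideanSpace ℝ (Fin N)) := ⟨ρ, 2 * ρ, hρ, by linarith⟩
  have hηC : ContDiff ℝ 1 η := η.contDiff
  refine ⟨∫ x, ‖fderiv ℝ η x‖ ^ p, fun k hk => ?_⟩
  -- The gradient of the bump lives in `ρ ≤ |y| ≤ 2ρ`. Dilating by powers of 4 makes these annuli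
  -- disjoint, so the `p`-th power of the sum of gradients is the sum of the `p`-th powers, and
  -- averaging gains `k^(-p) * k`.
  set c : ℕ → ℝ := fun j => ((4 : ℝ) ^ j)⁻¹ with hc
  have hc0 : ∀ j, 0 < c j := fun j => by positivity
  have hc1 : ∀ j, c j ≤ 1 := fun j => inv_le_one_of_one_le₀ (one_le_pow₀ (by norm_num))
  have hCj : ∀ j, ContDiff ℝ 1 fun x => η (c j • x) := fun j =>
    hηC.comp (contDiff_const_smul (c j))
  have hsj : ∀ j, HasCompactSupport fun x => η (c j • x) := fun j =>
    η.hasCompactSupport.comp_smul (hc0 j).ne'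
  have hfd : ∀ j x, fderiv ℝ (fun y => η (c j • y)) x = c j • fderiv ℝ η (c j • x) := fun j x =>
    fderiv_comp_smul (c j)
  set ζ : EuclideanSpace ℝ (Fin N) → ℝ := fun x => (k : ℝ)⁻¹ * ∑ j ∈ Finset.range k, η (c j • x)
    with hζ
  have hk0 : (0 : ℝ) < k := by exact_mod_cast hk
  have hζC : ContDiff ℝ 1 ζ := contDiff_const.mul (ContDiff.sum fun j _ => hCj j)
  have hζfd : ∀ x, fderiv ℝ ζ x =
      (k : ℝ)⁻¹ • ∑ j ∈ Finset.range k, c j • fderiv ℝ η (c j • x) := by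
    intro x
    simp only [hζ]
    rw [fderiv_const_mul (DifferentiableAt.fun_sum fun j _ => (hCj j).differentiable one_ne_zero x),
      fderiv_fun_sum fun j _ => (hCj j).differentiable one_ne_zero x]
    simp only [hfd]
  have hη1 : ∀ y, ‖y‖ < ρ → fderiv ℝ η y = 0 := by
    intro y hy
    have : (η : EuclideanSpace ℝ (Fin N) → ℝ) =ᶠ[𝓝 y] fun _ => 1 :=
      η.eventuallyEq_one_of_mem_ball (by simpa using hy)
    rw [this.fderiv_eq, fderiv_const_apply]
  have hη2 : ∀ y, 2 * ρ < ‖y‖ → fderiv ℝ η y = 0 := by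
    intro y hy
    have : (η : EuclideanSpace ℝ (Fin N) → ℝ) =ᶠ[𝓝 y] fun _ => 0 := by
      filter_upwards [continuousAt_const.eventually_lt continuous_norm.continuousAt hy] with z hz
      exact η.zero_of_le_dist (by simpa using hz.le)
    rw [this.fderiv_eq, fderiv_const_apply]
  have hdisj : ∀ x i j, i < j → fderiv ℝ η (c i • x) ≠ 0 → fderiv ℝ η (c j • x) = 0 := by
    intro x i j hij hi
    apply hη1
    have h1 : ‖c i • x‖ ≤ 2 * ρ := by
      by_contra! h
      exact hi (hη2 _ h)
    rw [norm_smul, Real.norm_of_nonneg (hc0 _).le] at h1 ⊢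
    have h2 : c j ≤ 4⁻¹ * c i := by
      simp only [hc]
      rw [← mul_inv, ← pow_succ']
      exact inv_anti₀ (by positivity) (pow_le_pow_right₀ (by norm_num) hij)
    nlinarith [mul_le_mul_of_nonneg_right h2 (norm_nonneg x)]
  have hpw : ∀ x, ‖fderiv ℝ ζ x‖ ^ p ≤
      (k : ℝ) ^ (-p) * ∑ j ∈ Finset.range k, c j ^ p * ‖fderiv ℝ η (c j • x)‖ ^ p := by
    intro x
    have hnn : ∀ j ∈ Finset.range k, 0 ≤ c j ^ p * ‖fderiv ℝ η (c j • x)‖ ^ p := fun j _ => by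
      have := hc0 j
      positivity
    rw [hζfd, norm_smul, Real.mul_rpow (norm_nonneg _) (norm_nonneg _),
      Real.norm_of_nonneg (inv_pos.2 hk0).le, Real.inv_rpow hk0.le, ← Real.rpow_neg hk0.le]
    refine mul_le_mul_of_nonneg_left ?_ (by positivity)
    by_cases h : ∃ i ∈ Finset.range k, fderiv ℝ η (c i • x) ≠ 0
    · obtain ⟨i, hi, hne⟩ := h
      rw [Finset.sum_eq_single_of_mem i hi]
      · rw [norm_smul, Real.norm_of_nonneg (hc0 i).le, Real.mul_rpow (hc0 i).le (norm_nonneg _)]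
        exact Finset.single_le_sum hnn hi
      · intro j _ hji
        rcases lt_or_gt_of_ne hji with h | h
        · by_contra hj
          exact hne (hdisj x j i h fun h0 => hj (by rw [h0, smul_zero]))
        · rw [hdisj x i j h hne, smul_zero]
    · push Not at h
      rw [Finset.sum_eq_zero fun j hj => by rw [h j hj, smul_zero], norm_zero,
        Real.zero_rpow hp0.ne']
      exact Finset.sum_nonneg hnn
  have hηi : Integrable fun x => ‖fderiv ℝ η x‖ ^ p := by
    refine Continuous.integrable_of_hasCompactSupport
      ((hηC.continuous_fderiv one_ne_zero).norm.rpow_const fun _ => Or.inr hp0.le) ?_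
    exact (η.hasCompactSupport.fderiv (𝕜 := ℝ)).comp_left (g := fun v => ‖v‖ ^ p)
      (by simp [hp0.ne'])
  have hij : ∀ j, Integrable fun x => c j ^ p * ‖fderiv ℝ η (c j • x)‖ ^ p := fun j =>
    (hηi.comp_smul (hc0 j).ne').const_mul _
  -- Scaling multiplies the energy by `c j ^ (p - N)`, which is at most 1 because `p ≥ N` and `c j ≤
  -- 1`.
  have hint : ∀ j, ∫ x, c j ^ p * ‖fderiv ℝ η (c j • x)‖ ^ p ≤ ∫ x, ‖fderiv ℝ η x‖ ^ p := by
    intro j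
    rw [integral_const_mul, Measure.integral_comp_smul volume (fun x => ‖fderiv ℝ η x‖ ^ p),
      finrank_euclideanSpace_fin, smul_eq_mul, ← mul_assoc]
    have h1 : 0 ≤ ∫ x, ‖fderiv ℝ η x‖ ^ p := integral_nonneg fun x => by positivity
    refine mul_le_of_le_one_left h1 ?_
    have h2 : 0 < c j ^ N := pow_pos (hc0 j) N
    rw [abs_of_nonneg (inv_pos.2 h2).le, ← div_eq_mul_inv, div_le_one h2, ← Real.rpow_natCast]
    exact Real.rpow_le_rpow_of_exponent_ge (hc0 j) (hc1 j) hNp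
  have hζs : HasCompactSupport ζ := by
    have : HasCompactSupport fun x => ∑ j ∈ Finset.range k, η (c j • x) := by
      refine HasCompactSupport.intro (K := ⋃ j ∈ Finset.range k, tsupport fun x => η (c j • x))
        ((Finset.range k).isCompact_biUnion fun j _ => hsj j) fun x hx => ?_
      refine Finset.sum_eq_zero fun j hj => ?_
      simp only [mem_iUnion, not_exists] at hx
      exact image_eq_zero_of_notMem_tsupport (f := fun x => η (c j • x)) (hx j hj)
    exact this.mul_left
  refine ⟨ζ, hζC, hζs, fun x => ?_, fun x hx => ?_, ?_⟩
  · exact mul_nonneg (inv_pos.2 hk0).le (Finset.sum_nonneg fun j _ => η.nonneg)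
  · have : ∀ j ∈ Finset.range k, η (c j • x) = 1 := fun j _ => by
      refine η.one_of_mem_closedBall ?_
      rw [mem_closedBall_zero_iff, norm_smul, Real.norm_of_nonneg (hc0 j).le]
      exact (mul_le_of_le_one_left (norm_nonneg x) (hc1 j)).trans hx
    simp only [hζ]
    rw [Finset.sum_congr rfl this]
    simp [hk0.ne']
  · simp only [norm_gradient]
    have hζi : Integrable fun x => ‖fderiv ℝ ζ x‖ ^ p := by
      refine Continuous.integrable_of_hasCompactSupport
        ((hζC.continuous_fderiv one_ne_zero).norm.rpow_const fun _ => Or.inr hp0.le) ?_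
      exact (hζs.fderiv (𝕜 := ℝ)).comp_left (g := fun v => ‖v‖ ^ p) (by simp [hp0.ne'])
    refine (integral_mono hζi
      ((integrable_finsetSum _ fun j _ => hij j).const_mul ((k : ℝ) ^ (-p))) hpw).trans ?_
    rw [integral_const_mul, integral_finsetSum _ fun j _ => hij j]
    calc (k : ℝ) ^ (-p) * ∑ j ∈ Finset.range k, ∫ x, c j ^ p * ‖fderiv ℝ η (c j • x)‖ ^ p
        ≤ (k : ℝ) ^ (-p) * ∑ j ∈ Finset.range k, ∫ x, ‖fderiv ℝ η x‖ ^ p :=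
          mul_le_mul_of_nonneg_left (Finset.sum_le_sum fun j _ => hint j) (by positivity)
      _ = (∫ x, ‖fderiv ℝ η x‖ ^ p) * (k : ℝ) ^ (1 - p) := by
          rw [Finset.sum_const, Finset.card_range, nsmul_eq_mul,
            show 1 - p = -p + 1 by ring, Real.rpow_add_one hk0.ne']
          ring

/-- Liouville property: for `p ≥ N` a nonnegative `p`-superharmonic function on `ℝ^N` has
vanishing gradient. -/
theorem gradient_eq_zero_of_nonneg_superharmonic {N : ℕ} {p : ℝ} (hp : 2 ≤ p) (hNp : (N : ℝ) ≤ p)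
    {u : EuclideanSpace ℝ (Fin N) → ℝ} (hu : ContDiff ℝ 1 u) (hu0 : ∀ x, 0 ≤ u x)
    (hsup : ∀ φ : EuclideanSpace ℝ (Fin N) → ℝ, ContDiff ℝ 1 φ → HasCompactSupport φ →
      (∀ x, 0 ≤ φ x) →
        0 ≤ ∫ x, inner ℝ (‖gradient u x‖ ^ (p - 2) • gradient u x) (gradient φ x))
    (x₀ : EuclideanSpace ℝ (Fin N)) : gradient u x₀ = 0 := by
  have hp0 : 0 < p := by linarith
  by_contra hne
  have hz : ∀ x, 0 < u x + 1 := fun x => by linarith [hu0 x]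
  set T : EuclideanSpace ℝ (Fin N) → ℝ := fun x => ‖gradient u x‖ / (u x + 1) with hT
  have hT0 : ∀ x, 0 ≤ T x := fun x => div_nonneg (norm_nonneg _) (hz x).le
  have hTc : Continuous T :=
    (continuous_gradient hu).norm.div (hu.continuous.add continuous_const) fun x => (hz x).ne'
  set ρ : ℝ := ‖x₀‖ + 1 with hρ
  -- A weight independent of `k`, equal to 1 at `x₀` and supported where every cutoff `ζ` is 1, so
  -- `b ≤ ζ^p`.
  let b : ContDiffBump (0 : EuclideanSpace ℝ (Fin N)) :=
    ⟨ρ, ρ + 1, by positivity, by linarith⟩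
  obtain ⟨C, hC⟩ := exists_cutoff_small_energy (N := N) (p := p) (by linarith) hNp
    (ρ := ρ + 1) (by positivity)
  have hFc : Continuous fun x => T x ^ p * b x :=
    (hTc.rpow_const fun _ => Or.inr hp0.le).mul b.continuous
  have hFs : HasCompactSupport fun x => T x ^ p * b x := b.hasCompactSupport.mul_left
  have hpos : 0 < ∫ x, T x ^ p * b x := by
    refine hFc.integral_pos_of_hasCompactSupport_nonneg_nonzero hFs (x := x₀)
      (fun x => mul_nonneg (Real.rpow_nonneg (hT0 x) _) b.nonneg) ?_
    have h1 : 0 < T x₀ := div_pos (norm_pos_iff.2 hne) (hz x₀)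
    have h2 : b x₀ = 1 := b.one_of_mem_closedBall (by
      rw [mem_closedBall_zero_iff]; change ‖x₀‖ ≤ ‖x₀‖ + 1; linarith)
    rw [h2, mul_one]
    exact (Real.rpow_pos_of_pos h1 _).ne'
  have hle : ∀ k : ℕ, 0 < k →
      ∫ x, T x ^ p * b x ≤ 2 * (2 * p) ^ p * (C * (k : ℝ) ^ (1 - p)) := by
    intro k hk
    obtain ⟨ζ, hζC, hζs, hζ0, hζ1, hζe⟩ := hC k hk
    have h1 := integral_log_gradient_le hp hu hu0 hsup hζC hζs hζ0
    refine le_trans ?_ (h1.trans (mul_le_mul_of_nonneg_left hζe (by positivity)))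
    refine integral_mono (hFc.integrable_of_hasCompactSupport hFs) ?_ fun x => ?_
    · refine Continuous.integrable_of_hasCompactSupport
        ((hTc.mul hζC.continuous).rpow_const fun _ => Or.inr hp0.le) ?_
      exact (hζs.mul_left (f := T)).comp_left (g := fun t : ℝ => t ^ p) (Real.zero_rpow hp0.ne')
    · change T x ^ p * b x ≤ (T x * ζ x) ^ p
      rcases le_total ‖x‖ (ρ + 1) with h | h
      · rw [hζ1 x h, mul_one]
        exact mul_le_of_le_one_right (Real.rpow_nonneg (hT0 x) _) b.le_one
      · rw [b.zero_of_le_dist (by simpa using h), mul_zero]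
        exact Real.rpow_nonneg (mul_nonneg (hT0 x) (hζ0 x)) _
  have hlim : Tendsto (fun k : ℕ => 2 * (2 * p) ^ p * (C * (k : ℝ) ^ (1 - p))) atTop (𝓝 0) := by
    have h1 : Tendsto (fun k : ℕ => (k : ℝ) ^ (1 - p)) atTop (𝓝 0) := by
      have := (tendsto_rpow_neg_atTop (y := p - 1) (by linarith)).comp
        (tendsto_natCast_atTop_atTop (R := ℝ))
      simpa [Function.comp_def] using this
    simpa using (h1.const_mul C).const_mul (2 * (2 * p) ^ p)
  have := ge_of_tendsto hlim ((eventually_gt_atTop 0).mono hle)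
  linarith

/-! ### Nonnegativity of solutions and conclusion -/

theorem gradient_comp_add_right {F : Type*} [NormedAddCommGroup F] [InnerProductSpace ℝ F]
    [CompleteSpace F] (u : F → ℝ) (z x : F) :
    gradient (fun y => u (y + z)) x = gradient u (x + z) := by
  simp only [gradient, fderiv_comp_add_right]

/-- Lets nonnegativity be checked at the origin alone, where the radial comparison is centred. -/
theorem IsSolution.comp_add_right {N : ℕ} {p : ℝ} {f : ℝ → ℝ} {u : EuclideanSpace ℝ (Fin N) → ℝ}
    (hu : IsSolution p f u) (z : EuclideanSpace ℝ (Fin N)) :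
    IsSolution p f fun x => u (x + z) := by
  refine ⟨hu.1.comp (contDiff_id.add contDiff_const), fun φ hφ hφs hφ0 => ?_⟩
  have h := hu.2 (fun x => φ (x + -z)) (hφ.comp (contDiff_id.add contDiff_const))
    (hφs.comp_homeomorph (Homeomorph.addRight (-z))) fun x => hφ0 _
  simp only [gradient_comp_add_right] at h ⊢
  rw [← integral_add_right_eq_self (fun x => f (u x) * φ (x + -z)) z,
    ← integral_add_right_eq_self (fun x => inner ℝ (‖gradient u x‖ ^ (p - 2) • gradient u x)
      (gradient φ (x + -z))) z] at h
  simpa using h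

/-- The Keller–Osserman condition in the variable `s = -t`. -/
theorem KellerOsserman.integrableOn_neg {p : ℝ} {f : ℝ → ℝ} (h : KellerOsserman p f) :
    IntegrableOn (fun s => (∫ τ in (1 : ℝ)..s, f (-τ)) ^ (-(1 / p))) (Ioi 1) := by
  have h1 := ((Measure.measurePreserving_neg (volume : Measure ℝ)).integrableOn_comp_preimage
    (Homeomorph.neg ℝ).measurableEmbedding).2 h
  simpa [Function.comp_def] using h1

/-- Under the Keller–Osserman condition solutions are nonnegative. -/
theorem IsSolution.nonneg {N : ℕ} (hN : 0 < N) {p : ℝ} (hp : 2 ≤ p) {f : ℝ → ℝ}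
    (hfc : Continuous f) (hf : PosAntitoneOnNeg f) (hKO : KellerOsserman p f)
    {u : EuclideanSpace ℝ (Fin N) → ℝ} (hu : IsSolution p f u) (x : EuclideanSpace ℝ (Fin N)) :
    0 ≤ u x := by
  suffices H : ∀ u : EuclideanSpace ℝ (Fin N) → ℝ, IsSolution p f u → 0 ≤ u 0 by
    simpa using H _ (hu.comp_add_right x)
  clear hu u x
  intro u hu
  by_contra! hneg
  have hN' : (0 : ℝ) < N := by exact_mod_cast hN
  -- Below 1 as the profile requires, and at most half of `w 0 = -u 0 > 0`, so that `w 0 ≤ a` is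
  -- absurd.
  set a : ℝ := min (1 / 2) (-u 0 / 2) with ha
  have ha0 : 0 < a := lt_min (by norm_num) (by linarith)
  have hgc : Continuous fun s => f (-s) := hfc.comp continuous_neg
  have hg : ∀ s : ℝ, 0 < s → 0 < f (-s) := fun s hs => hf.1 _ (by linarith)
  have hgm : MonotoneOn (fun s => f (-s)) (Ioi 0) := fun s hs t ht hst =>
    hf.2 (mem_Iio.2 (neg_lt_zero.2 ht)) (mem_Iio.2 (neg_lt_zero.2 hs)) (neg_le_neg hst)
  obtain ⟨R, hR⟩ := exists_radial_profile (g := fun s => f (-s)) (p := p) (a := a)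
    (c := 1 / (2 * N)) (by linarith) ha0 ((min_le_left _ _).trans_lt (by norm_num))
    (by positivity) hgc hg hgm hKO.integrableOn_neg
  set w : EuclideanSpace ℝ (Fin N) → ℝ := fun x => -u x with hw
  have hwC : ContDiff ℝ 1 w := hu.1.neg
  -- `R` does not depend on the level, so `w` can be bounded on this ball before choosing `M = max K
  -- a + 1`.
  obtain ⟨K, hK⟩ := (isCompact_closedBall (0 : EuclideanSpace ℝ (Fin N)) R).bddAbove_image
    hwC.continuous.continuousOn
  obtain ⟨R₁, hR₁, hR₁R, v, d, hvc, hvm, hv0, hvM, hdc, hd0, hvd⟩ :=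
    hR (max K a + 1) (by linarith [le_max_right K a])
  have hgrad : ∀ x, gradient w x = -gradient u x := by
    intro x
    simp only [gradient, hw]
    rw [fderiv_fun_neg, map_neg]
  have hle : w 0 ≤ a := by
    refine subsolution_apply_zero_le hN hp ha0 (by positivity) (by field_simp; exact le_rfl)
      hgc hg hgm hR₁ hvc hvm hv0 hvM hdc hd0 hvd hwC (fun x hx => ?_) fun φ hφ hφs hφ0 => ?_
    · have : w x ≤ K := hK ⟨x, by simpa using hx.trans hR₁R, rfl⟩
      linarith [le_max_left K a]
    · have h := hu.2 φ hφ hφs hφ0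
      simp only [hgrad, norm_neg, smul_neg, inner_neg_left, integral_neg, neg_neg]
      simpa [hw] using h
  have : a ≤ -u 0 / 2 := min_le_right _ _
  simp only [hw] at hle
  linarith

end PLaplace

end

theorem mainTheorem9 (N : ℕ) (hN : 1 < N) (p : ℝ) (hp : (N : ℝ) ≤ p)
    (f : ℝ → ℝ) (hfc : Continuous f) (hf_nonneg : ∀ t : ℝ, 0 ≤ f t)
    (hf : PLaplace.PosAntitoneOnNeg f) (hKO : PLaplace.KellerOsserman p f) :
    (∀ u : EuclideanSpace ℝ (Fin N) → ℝ, PLaplace.IsSolution p f u →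
        ∃ α : ℝ, 0 ≤ α ∧ f α = 0 ∧ ∀ x, u x = α) ∧
      ((∀ t : ℝ, 0 ≤ t → 0 < f t) →
        ¬ ∃ u : EuclideanSpace ℝ (Fin N) → ℝ, PLaplace.IsSolution p f u) := by
  have hp2 : 2 ≤ p := le_trans (by exact_mod_cast hN) hp
  have main : ∀ u : EuclideanSpace ℝ (Fin N) → ℝ, PLaplace.IsSolution p f u →
      ∃ α : ℝ, 0 ≤ α ∧ f α = 0 ∧ ∀ x, u x = α := by
    intro u hu
    have hu0 := hu.nonneg (by omega) hp2 hfc hf hKO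
    have hgrad : ∀ x, gradient u x = 0 := by
      refine PLaplace.gradient_eq_zero_of_nonneg_superharmonic hp2 hp hu.1 hu0
        fun φ hφ hφs hφ0 => ?_
      exact (integral_nonneg fun x => mul_nonneg (hf_nonneg _) (hφ0 x)).trans
        (hu.2 φ hφ hφs hφ0)
    have hconst : ∀ x, u x = u 0 := fun x =>
      is_const_of_fderiv_eq_zero (𝕜 := ℝ) (hu.1.differentiable one_ne_zero)
        (fun y => by rw [← toDual_gradient, hgrad, map_zero]) x 0
    refine ⟨u 0, hu0 0, le_antisymm ?_ (hf_nonneg _), hconst⟩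
    -- With `∇u = 0` the weak inequality for this bump reads `f (u 0) * ∫ b ≤ 0`.
    let b : ContDiffBump (0 : EuclideanSpace ℝ (Fin N)) := ⟨1, 2, one_pos, one_lt_two⟩
    have h := hu.2 b b.contDiff b.hasCompactSupport fun x => b.nonneg
    simp only [hgrad, smul_zero, inner_zero_left, integral_zero, hconst,
      integral_const_mul] at h
    exact nonpos_of_mul_nonpos_left h b.integral_pos
  refine ⟨main, fun hpos ⟨u, hu⟩ => ?_⟩
  obtain ⟨α, hα, hfα, -⟩ := main u hu
  exact (hpos α hα).ne' hfα
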